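/- Let $k\ge 1$ and let $\widehat{\mathbb{R}^k}=\mathbb{R}^k\cup\{\infty\}$ be the one-point compactification of $\mathbb{R}^k$, with the convention $c\cdot\infty=\infty$ for real $c\neq 0$. Let $\varphi:\widehat{\mathbb{R}^k}\to\widehat{\mathbb{R}^k}$ be a continuous function, not identically $0$, with $\varphi(\infty)=a\in\mathbb{R}^k$ finite, which satisfies $$(1-z)\,\varphi(x)=\varphi\Big(\varphi(xz)\,\frac{1-z}{z}\Big)$$ for all $x\in\widehat{\mathbb{R}^k}$ and all $z\in\mathbb{R}\setminus\{0,1\}$. Then $\varphi$ is a bijection of $\widehat{\mathbb{R}^k}$ onto itself. Moreover, for every $x\in\widehat{\mathbb{R}^k}$ and every integer $n\geq 1$, $$\frac1n\,\varphi(nx)=\underbrace{\varphi\circ\cdots\circ\varphi}_{n}(x)\qquad\text{and}\qquad \varphi^{-1}(-x)=-\varphi(x),$$ where $\varphi^{-1}$ denotes the inverse function. -/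

import Mathlib

namespace HomotheticEq

/-- The one-point compactification `ℝᵏ ∪ {∞}` of Euclidean space. -/
abbrev Hat (k : ℕ) : Type := OnePoint (EuclideanSpace ℝ (Fin k))

/-- Multiplication by a real scalar `c` on `ℝᵏ ∪ {∞}`: the usual one on `ℝᵏ`, with `c · ∞ = ∞`.
It is only used for `c ≠ 0`, where it is a homeomorphism (the product `0 · ∞` is meaningless). -/
noncomputable def scale {k : ℕ} (c : ℝ) : Hat k → Hat k :=
  OnePoint.map (fun v : EuclideanSpace ℝ (Fin k) => c • v)

/-- The functional equation `(1 - z) φ(x) = φ(φ(x z) (1 - z) / z)` on `ℝᵏ ∪ {∞}`, required for all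
points `x` and those `z` for which every scalar `z`, `1 - z`, `(1 - z) / z` is finite and
nonzero. -/
def SolvesEquation {k : ℕ} (φ : Hat k → Hat k) : Prop :=
  ∀ (x : Hat k) (z : ℝ), z ≠ 0 → z ≠ 1 →
    scale (1 - z) (φ x) = φ (scale ((1 - z) / z) (φ (scale z x)))

end HomotheticEq

/-!
Write `φ_u(x) = u⁻¹ φ(u x)` for real `u ≠ 0`. The functional equation says exactly that
`φ_w ∘ φ_u = φ_{w+u}` whenever `u`, `w` and `w + u` are nonzero
(`HomotheticEq.SolvesEquation.dilate_dilate`). This gives `φ_n = φ ∘ ⋯ ∘ φ` at once, and shows that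
the continuous map `ψ = φ_{-1} ∘ φ_1` is equal to `φ_{-u} ∘ φ_u` for every `u ≠ 0`, is idempotent,
commutes with nonzero scalars, and satisfies `φ ∘ ψ = φ`. Everything follows once `ψ` is known to be
the identity: the group law then makes `φ_{-1}` a two-sided inverse of `φ`.

At `x = ∞` the equation reads `φ(((1 - z) / z) a) = (1 - z) a`. Letting `z → 1` gives `φ(0) = 0`, and
for `a ≠ 0` letting `z → ∞` gives `φ(-a) = ∞`; hence `ψ` fixes `0` and `∞`. If `a = 0`, then
`ψ(∞) = 0`, but any nonzero value of `ψ` would be fixed along its whole ray and force `ψ(∞) = ∞`; so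
`ψ`, and with it `φ = φ ∘ ψ`, vanishes identically, which is excluded.

For `a ≠ 0`, homogeneity makes `ψ` preserve `ℝᵏ \ {0}`, so `r = ψ / ‖ψ‖` is an odd continuous
retraction of the unit sphere onto its image. Such a map is the identity
(`eq_of_odd_retraction_sphere`): if it moves `p`, then `-r` misses `p`, so stereographic projection
from `p` turns `-r` into a bounded continuous self-map of `ℝᵏ⁻¹`. Its fixed point gives
`y = -r(y)`; then `-y` and hence `y` lie in the image of `r`, so `r(y) = y = -y`, which is absurd.

The fixed point comes from Brouwer's theorem (`exists_isFixedPt_of_norm_le`), proved by the volume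
argument of Milnor and Rogers: a `C¹` retraction `f` of a ball onto its boundary has Jacobian
determinant zero, whereas `∫ det D(x + t (f(x) - x))` is a polynomial in `t` that is equal to the
volume of the ball for all small `t ≥ 0` (`setIntegral_det_fderiv_ball_eq`).
-/

open MeasureTheory Metric Set Filter Topology
open scoped Manifold

/-! ### The determinant along a segment from the identity -/

section Det

variable {E : Type*} [NormedAddCommGroup E] [NormedSpace ℝ E] [FiniteDimensional ℝ E]

theorem exists_polynomial_det_one_add_smul (A : E →L[ℝ] E) :
    ∃ p : Polynomial ℝ, p.natDegree ≤ Module.finrank ℝ E ∧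
      ∀ t : ℝ, (1 + t • A).det = p.eval t := by
  let b := Module.finBasis ℝ E
  let M := LinearMap.toMatrix b b (A : E →ₗ[ℝ] E)
  refine ⟨Matrix.det ((Polynomial.X : Polynomial ℝ) • M.map Polynomial.C
    + (1 : Matrix _ _ ℝ).map Polynomial.C), ?_, fun t => ?_⟩
  · simpa using Polynomial.natDegree_det_X_add_C_le M 1
  · rw [ContinuousLinearMap.det, ← LinearMap.det_toMatrix b, ← Polynomial.coe_evalRingHom,
      RingHom.map_det]
    congr 1
    ext i j
    by_cases hij : i = j <;>
      simp [M, hij, LinearMap.toMatrix_apply, add_comm] <;> ring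

/-- The determinant does not vanish on the segment from `1` to `1 + t • A`, since `s • A` is a strict
contraction there, and it is `1` at the start. -/
theorem det_one_add_smul_pos {A : E →L[ℝ] E} {K t : ℝ} (hA : ‖A‖ ≤ K) (ht : 0 ≤ t)
    (htK : t * K < 1) : 0 < (1 + t • A).det := by
  obtain ⟨p, -, hp⟩ := exists_polynomial_det_one_add_smul A
  have hne : ∀ s ∈ Icc 0 t, p.eval s ≠ 0 := by
    intro s hs h0
    rw [← hp] at h0
    have : ¬ Function.Injective (1 + s • A : E →L[ℝ] E) := by
      intro hinj
      have hker : LinearMap.ker ((1 + s • A : E →L[ℝ] E) : E →ₗ[ℝ] E) = ⊥ :=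
        LinearMap.ker_eq_bot.2 hinj
      have := LinearMap.bot_lt_ker_of_det_eq_zero (f := ((1 + s • A : E →L[ℝ] E) : E →ₗ[ℝ] E)) h0
      exact this.ne' hker
    apply this
    rw [injective_iff_map_eq_zero]
    intro v hv
    have hv' : v = -(s • A v) := by
      rw [eq_neg_iff_add_eq_zero]; simpa using hv
    by_contra hv0
    have hpos : 0 < ‖v‖ := norm_pos_iff.2 hv0
    have h1 : ‖v‖ ≤ s * (K * ‖v‖) := by
      calc ‖v‖ = ‖-(s • A v)‖ := by rw [← hv']
        _ = s * ‖A v‖ := by rw [norm_neg, norm_smul, Real.norm_of_nonneg hs.1]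
        _ ≤ s * (K * ‖v‖) := by
          gcongr
          · exact hs.1
          · exact (A.le_opNorm v).trans (by gcongr)
    have hK : 0 ≤ K := (norm_nonneg A).trans hA
    have h2 : s * K < 1 := lt_of_le_of_lt (by gcongr; exact hs.2) htK
    nlinarith
  have h0 : p.eval 0 = 1 := by rw [← hp]; simp [ContinuousLinearMap.det]
  rw [hp]
  by_contra! hle
  obtain ⟨s, hs, hs0⟩ := intermediate_value_Icc' ht p.continuous.continuousOn
    (show (0 : ℝ) ∈ Icc (p.eval t) (p.eval 0) from ⟨hle, by rw [h0]; exact zero_le_one⟩)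
  exact hne s hs hs0

end Det

/-! ### A Jacobian integral fixed by boundary values -/

section Volume

variable {E : Type*} [NormedAddCommGroup E] [NormedSpace ℝ E]

/-- A Lipschitz map on a closed ball that vanishes on the boundary extends by zero with the same
constant: a segment that leaves the ball crosses the sphere. -/
theorem LipschitzOnWith.indicator_closedBall {g : E → E} {K : NNReal} {ρ : ℝ}
    (hg : LipschitzOnWith K g (closedBall 0 ρ)) (h0 : ∀ x ∈ sphere (0 : E) ρ, g x = 0) :
    LipschitzWith K ((closedBall (0 : E) ρ).indicator g) := by
  have key : ∀ x ∈ closedBall (0 : E) ρ, ∀ y ∉ closedBall (0 : E) ρ,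
      dist (g x) 0 ≤ K * dist x y := by
    intro x hx y hy
    rw [mem_closedBall_zero_iff] at hx hy
    push Not at hy
    obtain ⟨s, hs, hsρ⟩ := intermediate_value_Icc (zero_le_one (α := ℝ))
      (f := fun s : ℝ => ‖x + s • (y - x)‖) (by fun_prop)
      (show ρ ∈ Icc _ _ from ⟨by simpa using hx, by simpa using hy.le⟩)
    have hz : x + s • (y - x) ∈ sphere (0 : E) ρ := by simpa using hsρ
    rw [← h0 _ hz]
    refine (hg.dist_le_mul x (by simpa using hx) _ (sphere_subset_closedBall hz)).trans ?_
    gcongr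
    rw [dist_self_add_right, norm_smul, Real.norm_of_nonneg hs.1, dist_comm, dist_eq_norm]
    exact mul_le_of_le_one_left (norm_nonneg _) hs.2
  refine LipschitzWith.of_dist_le_mul fun x y => ?_
  by_cases hx : x ∈ closedBall (0 : E) ρ <;> by_cases hy : y ∈ closedBall (0 : E) ρ
  · simpa [hx, hy] using hg.dist_le_mul x hx y hy
  · rw [indicator_of_mem hx, indicator_of_notMem hy]; exact key x hx y hy
  · rw [indicator_of_notMem hx, indicator_of_mem hy, dist_comm, dist_comm x]
    exact key y hy x hx
  · rw [indicator_of_notMem hx, indicator_of_notMem hy, dist_self]; positivity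

theorem LipschitzWith.bijective_id_add_smul [CompleteSpace E] {g : E → E} {K : NNReal}
    (hg : LipschitzWith K g) {t : ℝ} (ht : 0 ≤ t) (htK : t * K < 1) :
    Function.Bijective fun x => x + t • g x := by
  lift t to NNReal using ht
  have h : ApproximatesLinearOn (fun x => x + (t : ℝ) • g x)
      ((ContinuousLinearEquiv.refl ℝ E : E ≃L[ℝ] E) : E →L[ℝ] E) univ (t * K) := by
    rw [ApproximatesLinearOn.approximatesLinearOn_iff_lipschitzOnWith]
    refine (LipschitzWith.of_dist_le_mul fun x y => ?_).lipschitzOnWith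
    have := hg.dist_le_mul x y
    simp only [Pi.sub_apply, ContinuousLinearEquiv.coe_refl, ContinuousLinearMap.coe_id',
      id_eq, add_sub_cancel_left, dist_smul₀, Real.norm_eq_abs, NNReal.abs_eq, NNReal.coe_mul,
      mul_assoc]
    gcongr
  have hc : Subsingleton E ∨
      t * K < ‖((ContinuousLinearEquiv.refl ℝ E).symm : E →L[ℝ] E)‖₊⁻¹ := by
    rcases subsingleton_or_nontrivial E with hE | hE
    · exact Or.inl hE
    · right
      have : ‖((ContinuousLinearEquiv.refl ℝ E).symm : E →L[ℝ] E)‖₊ = 1 := by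
        simp
      rw [this, inv_one]
      exact_mod_cast htK
  exact ⟨injOn_univ.1 (h.injOn hc), h.surjective hc⟩

variable [FiniteDimensional ℝ E] [MeasurableSpace E] [BorelSpace E]
  (μ : Measure E) [μ.IsAddHaarMeasure]

/-- The integral over a ball of the Jacobian determinant of a `C¹` map that fixes the boundary sphere
is the volume of the ball. The signed determinant is essential: it is polynomial along the segment
from the identity to the map, so the case of small perturbations of the identity suffices. -/
theorem setIntegral_det_fderiv_ball_eq {f : E → E} {ρ : ℝ}
    (hf : ∀ x ∈ closedBall (0 : E) ρ, ContDiffAt ℝ 1 f x)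
    (hfix : ∀ x ∈ sphere (0 : E) ρ, f x = x) :
    ∫ x in ball (0 : E) ρ, (fderiv ℝ f x).det ∂μ = μ.real (ball (0 : E) ρ) := by
  set D : E → E →L[ℝ] E := fun x => fderiv ℝ f x - 1 with hD
  have hDcont : ContinuousOn D (closedBall 0 ρ) := fun x hx =>
    (((hf x hx).fderiv_right (m := 0) (by simp)).continuousAt.sub
      continuousAt_const).continuousWithinAt
  obtain ⟨K, hK⟩ : ∃ K : NNReal, ∀ x ∈ closedBall (0 : E) ρ, ‖D x‖ ≤ K := by
    obtain ⟨C, hC⟩ := (isCompact_closedBall (0 : E) ρ).exists_bound_of_continuousOn hDcont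
    exact ⟨C.toNNReal, fun x hx => (hC x hx).trans (Real.le_coe_toNNReal C)⟩
  have hder : ∀ x ∈ closedBall (0 : E) ρ, HasFDerivAt (fun x => f x - x) (D x) x := fun x hx =>
    ((hf x hx).differentiableAt (by simp)).hasFDerivAt.sub (hasFDerivAt_id x)
  have hLip : LipschitzOnWith K (fun x => f x - x) (closedBall 0 ρ) :=
    (convex_closedBall 0 ρ).lipschitzOnWith_of_nnnorm_hasFDerivWithin_le
      (fun x hx => (hder x hx).hasFDerivWithinAt) fun x hx => by exact_mod_cast hK x hx
  set g : E → E := (closedBall (0 : E) ρ).indicator fun x => f x - x with hg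
  have hgLip : LipschitzWith K g :=
    hLip.indicator_closedBall fun x hx => by rw [hfix x hx, sub_self]
  have hg0 : ∀ x ∉ ball (0 : E) ρ, g x = 0 := by
    intro x hx
    by_cases hx' : x ∈ closedBall (0 : E) ρ
    · rw [hg, indicator_of_mem hx', hfix, sub_self]
      simp only [mem_ball, mem_closedBall, mem_sphere, not_lt] at *
      exact le_antisymm hx' hx
    · exact indicator_of_notMem hx' _
  have hdet : Continuous fun A : E →L[ℝ] E => A.det := ContinuousLinearMap.continuous_det
  have hint : ∀ t : ℝ, IntegrableOn (fun x => (1 + t • D x).det) (ball 0 ρ) μ := fun t =>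
    ((hdet.comp_continuousOn (continuousOn_const.add (hDcont.const_smul t))).integrableOn_compact
      (isCompact_closedBall 0 ρ)).mono_set ball_subset_closedBall
  -- For small `t` the map `x + t • g x` is a bijection fixing every point off the open ball, so it
  -- maps the ball onto itself and has positive Jacobian determinant there.
  have hsmall : ∀ t : ℝ, 0 ≤ t → t * K < 1 →
      ∫ x in ball (0 : E) ρ, (1 + t • D x).det ∂μ = μ.real (ball (0 : E) ρ) := by
    intro t ht htK
    have hbij := hgLip.bijective_id_add_smul ht htK
    have himg : (fun x => x + t • g x) '' ball 0 ρ = ball 0 ρ := by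
      have : (fun x => x + t • g x) '' (ball 0 ρ)ᶜ = (ball 0 ρ)ᶜ := by
        rw [image_congr (g := id), image_id]
        intro x hx; simp [hg0 x hx]
      rw [image_compl_eq hbij, compl_inj_iff] at this
      exact this
    have hcv := integral_image_eq_integral_abs_det_fderiv_smul μ
      (measurableSet_ball (x := (0 : E)) (ε := ρ))
      (f := fun x => x + t • g x) (f' := fun x => 1 + t • D x)
      (fun x hx => by
        have h1 : HasFDerivWithinAt g (D x) (ball 0 ρ) x :=
          (hder x (ball_subset_closedBall hx)).hasFDerivWithinAt.congr
            (fun y hy => indicator_of_mem (ball_subset_closedBall hy) _)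
            (indicator_of_mem (ball_subset_closedBall hx) _)
        exact (hasFDerivWithinAt_id x _).add (h1.const_smul t))
      hbij.injective.injOn (fun _ => (1 : ℝ))
    rw [himg, setIntegral_const, smul_eq_mul, mul_one] at hcv
    rw [hcv]
    refine setIntegral_congr_fun measurableSet_ball fun x hx => ?_
    have := det_one_add_smul_pos (hK x (ball_subset_closedBall hx)) ht htK
    simp [abs_of_pos this]
  -- The determinant has degree at most `n` in `t`, so its value at `t = 1` is a fixed linear
  -- combination, with coefficients summing to `1`, of its values at the `n + 1` small nodes `v j`.
  set n := Module.finrank ℝ E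
  set δ : ℝ := 1 / ((n + 1) * (K + 1)) with hδ
  have hδpos : 0 < δ := by positivity
  let v : ℕ → ℝ := fun j => j * δ
  have hv : Set.InjOn v (Finset.range (n + 1)) := fun i _ j _ hij => by
    have := mul_right_cancel₀ hδpos.ne' hij
    exact_mod_cast this
  have hnode : ∀ j ∈ Finset.range (n + 1), 0 ≤ v j ∧ v j * K < 1 := by
    intro j hj
    have hj' : (j : ℝ) < n + 1 := by exact_mod_cast Finset.mem_range.1 hj
    have hK0 : (0 : ℝ) ≤ K := K.2
    refine ⟨by positivity, ?_⟩
    simp only [v, hδ]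
    rw [mul_one_div, div_mul_eq_mul_div, div_lt_one (by positivity)]
    have hj0 : (0 : ℝ) ≤ j := j.cast_nonneg
    nlinarith
  have hinterp : ∀ x, (fderiv ℝ f x).det =
      ∑ j ∈ Finset.range (n + 1),
        (1 + v j • D x).det * (Lagrange.basis (Finset.range (n + 1)) v j).eval 1 := by
    intro x
    obtain ⟨p, hpdeg, hp⟩ := exists_polynomial_det_one_add_smul (D x)
    have h1 : (fderiv ℝ f x).det = p.eval 1 := by
      rw [← hp]; simp [hD]
    rw [h1, Lagrange.eq_interpolate_of_eval_eq (f := p) (fun j => (1 + v j • D x).det) hv ?_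
      (fun j _ => (hp _).symm), Lagrange.interpolate_apply, Polynomial.eval_finsetSum]
    · simp
    · rw [Finset.card_range]
      exact (Polynomial.degree_le_of_natDegree_le hpdeg).trans_lt (by exact_mod_cast n.lt_succ_self)
  have hone : ∑ j ∈ Finset.range (n + 1),
      (Lagrange.basis (Finset.range (n + 1)) v j).eval 1 = (1 : ℝ) := by
    rw [← Polynomial.eval_finsetSum, Lagrange.sum_basis hv ⟨0, by simp⟩, Polynomial.eval_one]
  simp_rw [hinterp]
  rw [integral_finsetSum _ fun j _ => (hint _).mul_const _]
  simp_rw [integral_mul_const]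
  rw [Finset.sum_congr rfl fun j hj => by rw [hsmall _ (hnode j hj).1 (hnode j hj).2],
    ← Finset.mul_sum, hone, mul_one]

end Volume

/-! ### Brouwer's fixed point theorem -/

section Brouwer

variable {E : Type*} [NormedAddCommGroup E] [InnerProductSpace ℝ E]

/-- If `G` has no fixed point, sending `x` to the point where the ray from `G x` through `x` meets the
sphere retracts the ball onto its boundary. -/
theorem exists_contDiffAt_retraction_of_forall_ne {G : E → E} (hG : ContDiff ℝ 1 G) {ρ : ℝ}
    (hρ : 0 < ρ) (hball : ∀ x, ‖G x‖ < ρ) (hne : ∀ x, G x ≠ x) :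
    ∃ f : E → E, (∀ x ∈ closedBall (0 : E) ρ, ContDiffAt ℝ 1 f x) ∧
      (∀ x ∈ sphere (0 : E) ρ, f x = x) ∧ ∀ x ∈ closedBall (0 : E) ρ, ‖f x‖ = ρ := by
  -- `s x` is the larger root `s` of the quadratic equation `‖x + s • u x‖ ^ 2 = ρ ^ 2`, and `d x` is a
  -- quarter of its discriminant, positive on the closed ball.
  let u : E → E := fun x => x - G x
  let q : E → ℝ := fun x => inner ℝ x (u x)
  let d : E → ℝ := fun x => q x ^ 2 + ‖u x‖ ^ 2 * (ρ ^ 2 - ‖x‖ ^ 2)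
  let s : E → ℝ := fun x => (√(d x) - q x) / ‖u x‖ ^ 2
  have hu : ∀ x, 0 < ‖u x‖ ^ 2 := fun x => by
    have : u x ≠ 0 := sub_ne_zero.2 (hne x).symm
    positivity
  have hq : ∀ x ∈ sphere (0 : E) ρ, 0 < q x := by
    intro x hx
    rw [mem_sphere_zero_iff_norm] at hx
    have h1 : inner ℝ x (G x) ≤ ‖x‖ * ‖G x‖ := real_inner_le_norm _ _
    have h2 : ‖x‖ * ‖G x‖ < ρ * ρ := by rw [hx]; gcongr; exact hball x
    simp only [q, u, inner_sub_right, real_inner_self_eq_norm_mul_norm, hx]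
    linarith
  have hd : ∀ x ∈ closedBall (0 : E) ρ, 0 < d x := by
    intro x hx
    rcases (mem_closedBall_zero_iff.1 hx).lt_or_eq with h | h
    · have : 0 < ρ ^ 2 - ‖x‖ ^ 2 := by nlinarith [norm_nonneg x]
      have := mul_pos (hu x) this
      simp only [d]; positivity
    · have := hq x (mem_sphere_zero_iff_norm.2 h)
      simp only [d, h, sub_self, mul_zero, add_zero]; positivity
  have huC : ContDiff ℝ 1 u := contDiff_id.sub hG
  have hqC : ContDiff ℝ 1 q := contDiff_id.inner ℝ huC
  have hdC : ContDiff ℝ 1 d :=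
    (hqC.pow 2).add ((huC.norm_sq ℝ).mul (contDiff_const.sub (contDiff_id.norm_sq ℝ)))
  refine ⟨fun x => x + s x • u x, fun x hx => ?_, fun x hx => ?_, fun x hx => ?_⟩
  · exact contDiffAt_id.add
      ((((hdC.contDiffAt.sqrt (hd x hx).ne').sub hqC.contDiffAt).div
        (huC.norm_sq ℝ).contDiffAt (hu x).ne').smul huC.contDiffAt)
  · have : s x = 0 := by
      simp only [s, d, mem_sphere_zero_iff_norm.1 hx, sub_self, mul_zero, add_zero,
        Real.sqrt_sq (hq x hx).le, zero_div]
    simp [this]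
  · have h1 : ‖x + s x • u x‖ ^ 2 = ‖x‖ ^ 2 + 2 * (s x * q x) + s x ^ 2 * ‖u x‖ ^ 2 := by
      rw [norm_add_sq_real, inner_smul_right, norm_smul, mul_pow, Real.norm_eq_abs, sq_abs]
    have h2 : s x * ‖u x‖ ^ 2 = √(d x) - q x := div_mul_cancel₀ _ (hu x).ne'
    have h3 : √(d x) ^ 2 = q x ^ 2 + ‖u x‖ ^ 2 * (ρ ^ 2 - ‖x‖ ^ 2) := Real.sq_sqrt (hd x hx).le
    have h4 : ‖x + s x • u x‖ ^ 2 = ρ ^ 2 := by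
      rw [h1]
      apply mul_right_cancel₀ (hu x).ne'
      linear_combination h3 + (s x * ‖u x‖ ^ 2 + √(d x) + q x) * h2
    exact (pow_left_inj₀ (norm_nonneg _) hρ.le two_ne_zero).1 h4

variable [FiniteDimensional ℝ E]

/-- The `C¹` no-retraction theorem for balls. -/
theorem not_exists_contDiffAt_retraction {ρ : ℝ} (hρ : 0 < ρ) :
    ¬ ∃ f : E → E, (∀ x ∈ closedBall (0 : E) ρ, ContDiffAt ℝ 1 f x) ∧
      (∀ x ∈ sphere (0 : E) ρ, f x = x) ∧ ∀ x ∈ closedBall (0 : E) ρ, ‖f x‖ = ρ := by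
  rintro ⟨f, hf, hfix, hnorm⟩
  borelize E
  have hvol := setIntegral_det_fderiv_ball_eq (Measure.addHaar : Measure E) hf hfix
  have hpos : 0 < (Measure.addHaar : Measure E).real (ball 0 ρ) :=
    ENNReal.toReal_pos (measure_ball_pos _ _ hρ).ne' measure_ball_lt_top.ne
  have hzero : ∀ x ∈ ball (0 : E) ρ, (fderiv ℝ f x).det = 0 := by
    intro x hx
    have hx' := ball_subset_closedBall hx
    have hd := ((hf x hx').differentiableAt (by simp)).hasFDerivAt
    -- The image of the derivative is orthogonal to the nonzero vector `f x`.
    have horth : ∀ v, inner ℝ (f x) (fderiv ℝ f x v) = 0 := by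
      have h1 := hd.norm_sq
      have h2 : HasFDerivAt (fun y => ‖f y‖ ^ 2) (0 : E →L[ℝ] ℝ) x :=
        (hasFDerivAt_const (ρ ^ 2) x).congr_of_eventuallyEq
          (by filter_upwards [isOpen_ball.mem_nhds hx] with y hy
              rw [hnorm y (ball_subset_closedBall hy)])
      intro v
      have := congrArg (fun L : E →L[ℝ] ℝ => L v) (h1.unique h2)
      simpa using this
    by_contra hdet
    have hsurj : Function.Surjective (fderiv ℝ f x) := by
      have := (LinearMap.equivOfDetNeZero (fderiv ℝ f x : E →ₗ[ℝ] E) hdet).surjective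
      exact this
    obtain ⟨v, hv⟩ := hsurj (f x)
    have h0 := horth v
    rw [hv, real_inner_self_eq_norm_sq, hnorm x hx'] at h0
    exact (pow_pos hρ 2).ne' h0
  rw [setIntegral_congr_fun measurableSet_ball hzero] at hvol
  simp at hvol
  exact hpos.ne hvol

/-- **Brouwer's fixed point theorem** for bounded continuous self-maps of a finite-dimensional inner
product space. -/
theorem exists_isFixedPt_of_norm_le {F : E → E} (hF : Continuous F) {M : ℝ}
    (hM : ∀ x, ‖F x‖ ≤ M) : ∃ x, F x = x := by
  by_contra! hne
  have hM0 : 0 ≤ M := (norm_nonneg _).trans (hM 0)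
  -- Approximate `F` by a `C¹` map that is bounded by `M + 1` and still has no fixed point.
  obtain ⟨G, hG⟩ := exists_contMDiffMap_forall_mem_convex_of_local_const (n := 1) 𝓘(ℝ, E)
    (t := fun x => ball (F x) (min 1 ‖F x - x‖)) (fun x => convex_ball _ _) (fun x => by
      refine ⟨F x, ?_⟩
      have h1 : Continuous fun y => dist (F x) (F y) := by fun_prop
      have h2 : Continuous fun y => min 1 ‖F y - y‖ := by fun_prop
      refine h1.continuousAt.eventually_lt h2.continuousAt ?_
      have := hne x
      simpa [sub_eq_zero] using this)
  refine not_exists_contDiffAt_retraction (E := E) (ρ := M + 1) (by positivity)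
    (exists_contDiffAt_retraction_of_forall_ne (G := G) G.contMDiff.contDiff (by positivity) ?_ ?_)
  · intro x
    have h1 := mem_ball.1 (hG x)
    have h2 : dist (G x) (F x) < 1 := h1.trans_le (min_le_left _ _)
    rw [dist_eq_norm] at h2
    have h3 : ‖G x‖ ≤ ‖F x‖ + ‖G x - F x‖ := norm_le_norm_add_norm_sub' _ _
    linarith [hM x]
  · intro x hx
    have h1 := (mem_ball.1 (hG x)).trans_le (min_le_right _ _)
    rw [hx, dist_comm, dist_eq_norm] at h1
    exact lt_irrefl _ h1

end Brouwer

/-! ### Odd retractions of a sphere -/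

/-- The unit sphere has no odd continuous retraction onto a proper subset. -/
theorem eq_of_odd_retraction_sphere {E : Type*} [NormedAddCommGroup E] [InnerProductSpace ℝ E]
    [FiniteDimensional ℝ E] {r : sphere (0 : E) 1 → sphere (0 : E) 1} (hr : Continuous r)
    (hodd : ∀ x, r (-x) = -r x) (hidem : ∀ x, r (r x) = r x) (p : sphere (0 : E) 1) :
    r p = p := by
  by_contra hp
  have hmiss : ∀ y, -r y ≠ p := by
    intro y hy
    rw [← hodd] at hy
    exact hp (by rw [← hy, hidem])
  have hE : Nontrivial E := ⟨p, 0, fun h => by simpa [h] using p.2⟩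
  obtain ⟨n, hn⟩ := Nat.exists_eq_succ_of_ne_zero (Module.finrank_pos (R := ℝ) (M := E)).ne'
  have : Fact (Module.finrank ℝ E = n + 1) := ⟨hn⟩
  let σ := stereographic' n p
  have hsource : ∀ y, -r y ∈ σ.source := fun y => by
    simpa [σ, stereographic'_source] using hmiss y
  have hH : Continuous fun y => σ (-r y) :=
    σ.continuousOn.comp_continuous hr.neg hsource
  have hsymm : Continuous σ.symm :=
    continuousOn_univ.1 (by simpa [σ, stereographic'_target] using σ.continuousOn_symm)
  obtain ⟨M, hM⟩ := isCompact_univ.exists_bound_of_continuousOn hH.continuousOn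
  obtain ⟨w, hw⟩ := exists_isFixedPt_of_norm_le (hH.comp hsymm) fun w => hM (σ.symm w) (mem_univ _)
  -- The fixed point of `-r` lies in the image of `r`, where `r` is the identity.
  have hy : -r (σ.symm w) = σ.symm w := by
    conv_rhs => rw [← hw]
    exact (σ.left_inv (hsource _)).symm
  have h1 := hidem (σ.symm w)
  have h2 : r (σ.symm w) = -σ.symm w := neg_eq_iff_eq_neg.1 hy
  rw [h2, hodd, h2, neg_neg] at h1
  have h3 : ((σ.symm w : sphere (0 : E) 1) : E) = -(σ.symm w : sphere (0 : E) 1) :=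
    congrArg Subtype.val h1
  exact ne_neg_of_mem_unit_sphere ℝ _ h1

namespace HomotheticEq

variable {k : ℕ}

/-! ### Scaling on the one-point compactification -/

section Scale

@[simp] theorem scale_coe (c : ℝ) (v : EuclideanSpace ℝ (Fin k)) :
    scale c (v : Hat k) = ((c • v : EuclideanSpace ℝ (Fin k)) : Hat k) := rfl

@[simp] theorem scale_infty (c : ℝ) : scale c (OnePoint.infty : Hat k) = OnePoint.infty := rfl

@[simp] theorem scale_scale (c d : ℝ) (x : Hat k) : scale c (scale d x) = scale (c * d) x := by
  induction x using OnePoint.rec <;> simp [mul_smul]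

@[simp] theorem scale_one (x : Hat k) : scale 1 x = x := by
  induction x using OnePoint.rec <;> simp

theorem continuous_scale {c : ℝ} (hc : c ≠ 0) : Continuous (scale c : Hat k → Hat k) :=
  OnePoint.continuous_map (continuous_const_smul c)
    (by simpa [Filter.coclosedCompact_eq_cocompact] using
      (Homeomorph.smulOfNeZero (α := EuclideanSpace ℝ (Fin k)) c
        hc).isClosedEmbedding.tendsto_cocompact)

theorem tendsto_coe_smul_infty {α : Type*} {l : Filter α} {c : α → ℝ}
    (hc : Tendsto (fun i => |c i|) l atTop) {v : EuclideanSpace ℝ (Fin k)} (hv : v ≠ 0) :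
    Tendsto (fun i => ((c i • v : EuclideanSpace ℝ (Fin k)) : Hat k)) l (𝓝 OnePoint.infty) := by
  refine OnePoint.tendsto_coe_infty.comp ?_
  rw [Filter.coclosedCompact_eq_cocompact, ← Metric.cobounded_eq_cocompact,
    ← tendsto_norm_atTop_iff_cobounded]
  simp only [norm_smul, Real.norm_eq_abs]
  exact hc.atTop_mul_const (norm_pos_iff.2 hv)

theorem tendsto_coe_smul {α : Type*} {l : Filter α} {c : α → ℝ} {b : ℝ}
    (hc : Tendsto c l (𝓝 b)) (v : EuclideanSpace ℝ (Fin k)) :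
    Tendsto (fun i => ((c i • v : EuclideanSpace ℝ (Fin k)) : Hat k)) l
      (𝓝 ((b • v : EuclideanSpace ℝ (Fin k)) : Hat k)) :=
  (OnePoint.continuous_coe.tendsto _).comp (hc.smul_const v)

end Scale

/-! ### Homogeneous retractions -/

section Retraction

variable {ψ : Hat k → Hat k}

/-- A value `∞` at a finite point would spread along its ray to the origin. -/
theorem eq_infty_of_map_eq_infty (hψ : Continuous ψ)
    (hhom : ∀ (c : ℝ) (x : Hat k), c ≠ 0 → ψ (scale c x) = scale c (ψ x))
    (hzero : ψ ((0 : EuclideanSpace ℝ (Fin k)) : Hat k) = ((0 : EuclideanSpace ℝ (Fin k)) : Hat k))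
    {x : Hat k} (hx : ψ x = OnePoint.infty) : x = OnePoint.infty := by
  induction x using OnePoint.rec with
  | infty => rfl
  | coe v =>
    have h1 : Tendsto (fun c : ℝ => ψ ((c • v : EuclideanSpace ℝ (Fin k)) : Hat k)) (𝓝[≠] 0)
        (𝓝 (ψ (((0 : ℝ) • v : EuclideanSpace ℝ (Fin k)) : Hat k))) :=
      (hψ.tendsto _).comp (tendsto_coe_smul (tendsto_id.mono_left nhdsWithin_le_nhds) v)
    have h2 : Tendsto (fun c : ℝ => ψ ((c • v : EuclideanSpace ℝ (Fin k)) : Hat k)) (𝓝[≠] 0)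
        (𝓝 OnePoint.infty) := by
      refine tendsto_const_nhds.congr' ?_
      filter_upwards [self_mem_nhdsWithin] with c hc
      rw [← scale_coe, hhom c _ hc, hx, scale_infty]
    have h3 := tendsto_nhds_unique h1 h2
    rw [zero_smul, hzero] at h3
    exact absurd h3 (OnePoint.coe_ne_infty _)

/-- A scale-invariant value (`0` or `∞`) at a finite nonzero point spreads along its ray to `∞`. -/
theorem map_infty_eq_of_map_coe_eq (hψ : Continuous ψ)
    (hhom : ∀ (c : ℝ) (x : Hat k), c ≠ 0 → ψ (scale c x) = scale c (ψ x))
    {v : EuclideanSpace ℝ (Fin k)} (hv : v ≠ 0) {y : Hat k} (hy : ∀ c : ℝ, c ≠ 0 → scale c y = y)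
    (hvy : ψ v = y) : ψ OnePoint.infty = y := by
  have h1 : Tendsto (fun c : ℝ => ψ ((c • v : EuclideanSpace ℝ (Fin k)) : Hat k)) atTop
      (𝓝 (ψ OnePoint.infty)) :=
    (hψ.tendsto _).comp (tendsto_coe_smul_infty tendsto_abs_atTop_atTop hv)
  refine tendsto_nhds_unique h1 (tendsto_const_nhds.congr' ?_)
  filter_upwards [eventually_ne_atTop (0 : ℝ)] with c hc
  rw [← scale_coe, hhom c _ hc, hvy, hy c hc]

theorem eq_self_of_homogeneous_retraction (hψ : Continuous ψ)
    (hhom : ∀ (c : ℝ) (x : Hat k), c ≠ 0 → ψ (scale c x) = scale c (ψ x))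
    (hidem : ∀ x, ψ (ψ x) = ψ x)
    (hzero : ψ ((0 : EuclideanSpace ℝ (Fin k)) : Hat k) = ((0 : EuclideanSpace ℝ (Fin k)) : Hat k))
    (hinfty : ψ OnePoint.infty = OnePoint.infty) (x : Hat k) : ψ x = x := by
  have hfin : ∀ v : EuclideanSpace ℝ (Fin k), ∃ w : EuclideanSpace ℝ (Fin k),
      (w : Hat k) = ψ v := fun v =>
    OnePoint.ne_infty_iff_exists.1 fun h =>
      OnePoint.coe_ne_infty v (eq_infty_of_map_eq_infty hψ hhom hzero h)
  -- `f` is the restriction of `ψ` to finite points, and `r` its normalization on the sphere.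
  choose f hf using hfin
  have hfcont : Continuous f := by
    rw [OnePoint.isOpenEmbedding_coe.isEmbedding.continuous_iff]
    convert hψ.comp OnePoint.continuous_coe using 1
    exact funext hf
  have hfhom : ∀ (c : ℝ) v, c ≠ 0 → f (c • v) = c • f v := fun c v hc => by
    rw [← OnePoint.coe_eq_coe, hf, ← scale_coe, hhom c _ hc, ← hf, scale_coe]
  have hfidem : ∀ v, f (f v) = f v := fun v => by
    rw [← OnePoint.coe_eq_coe, hf, hf, hidem]
  have hfne : ∀ v, v ≠ 0 → f v ≠ 0 := fun v hv h0 => by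
    have := map_infty_eq_of_map_coe_eq hψ hhom hv (y := ((0 : EuclideanSpace ℝ (Fin k)) : Hat k))
      (by simp) (by rw [← hf, h0])
    rw [hinfty] at this
    exact OnePoint.infty_ne_coe _ this
  have hfne' : ∀ p : sphere (0 : EuclideanSpace ℝ (Fin k)) 1, f p ≠ 0 := fun p =>
    hfne p (ne_zero_of_mem_unit_sphere p)
  let r : sphere (0 : EuclideanSpace ℝ (Fin k)) 1 → sphere (0 : EuclideanSpace ℝ (Fin k)) 1 :=
    fun p => ⟨‖f p‖⁻¹ • f p, by simp [norm_smul, hfne' p]⟩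
  have hr : Continuous r := by
    have : Continuous fun p : sphere (0 : EuclideanSpace ℝ (Fin k)) 1 => f p :=
      hfcont.comp continuous_subtype_val
    exact ((this.norm.inv₀ fun p => norm_ne_zero_iff.2 (hfne' p)).smul this).subtype_mk _
  have hfr : ∀ p, f (r p) = r p := fun p => by
    change f (‖f p‖⁻¹ • f p) = ‖f p‖⁻¹ • f p
    rw [hfhom _ _ (inv_ne_zero (norm_ne_zero_iff.2 (hfne' p))), hfidem]
  have hrid := eq_of_odd_retraction_sphere hr
    (fun p => Subtype.ext (by
      have := hfhom (-1) p (by norm_num)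
      simp only [neg_smul, one_smul] at this
      simp [r, this]))
    (fun p => Subtype.ext (by
      change ‖f (r p)‖⁻¹ • f (r p) = r p
      rw [hfr]; simp))
  induction x using OnePoint.rec with
  | infty => exact hinfty
  | coe v =>
    rcases eq_or_ne v 0 with rfl | hv
    · exact hzero
    · rw [← hf, OnePoint.coe_eq_coe]
      have hn : ‖v‖ ≠ 0 := norm_ne_zero_iff.2 hv
      have h1 := hfr ⟨‖v‖⁻¹ • v, by simp [norm_smul, hv]⟩
      rw [hrid] at h1
      rw [hfhom _ _ (inv_ne_zero hn)] at h1
      exact smul_right_injective _ (inv_ne_zero hn) h1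

end Retraction

/-! ### The one-parameter family of a solution -/

section Solution

/-- The conjugate `φ_u : x ↦ u⁻¹ φ(u x)` of `φ` by multiplication by `u`, meaningful for `u ≠ 0`. -/
noncomputable def dilate (φ : Hat k → Hat k) (u : ℝ) (x : Hat k) : Hat k :=
  scale u⁻¹ (φ (scale u x))

variable {φ : Hat k → Hat k}

@[simp] theorem dilate_one (x : Hat k) : dilate φ 1 x = φ x := by simp [dilate]

theorem continuous_dilate (hφ : Continuous φ) {u : ℝ} (hu : u ≠ 0) : Continuous (dilate φ u) :=
  (continuous_scale (inv_ne_zero hu)).comp (hφ.comp (continuous_scale hu))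

theorem dilate_scale {c u : ℝ} (hc : c ≠ 0) (x : Hat k) :
    dilate φ u (scale c x) = scale c (dilate φ (u * c) x) := by
  simp [dilate, hc]

/-- The functional equation as a group law: `φ_w ∘ φ_u = φ_{w+u}`. -/
theorem SolvesEquation.dilate_dilate (h : SolvesEquation φ) {u w : ℝ} (hu : u ≠ 0) (hw : w ≠ 0)
    (huw : w + u ≠ 0) (x : Hat k) : dilate φ w (dilate φ u x) = dilate φ (w + u) x := by
  have h1 : u / (w + u) ≠ 1 := fun h => hw (by rw [div_eq_one_iff_eq huw] at h; linarith)
  have h2 := h (scale (w + u) x) (u / (w + u)) (div_ne_zero hu huw) h1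
  have h3 : 1 - u / (w + u) = w * (w + u)⁻¹ := by field_simp; ring
  have h4 : w * (w + u)⁻¹ / (u / (w + u)) = w * u⁻¹ := by field_simp
  rw [h3, h4, scale_scale, div_mul_cancel₀ _ huw] at h2
  rw [dilate, dilate, scale_scale, ← h2, scale_scale, inv_mul_cancel_left₀ hw, dilate]

/-- The map `φ_{-1} ∘ φ`, where `φ_u = dilate φ u`. It is idempotent when `φ` solves the equation; the
name refers to that case. -/
noncomputable def retraction (φ : Hat k → Hat k) (x : Hat k) : Hat k :=
  dilate φ (-1) (φ x)

theorem continuous_retraction (hφ : Continuous φ) : Continuous (retraction φ) :=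
  (continuous_dilate hφ (by norm_num)).comp hφ

theorem SolvesEquation.dilate_neg_dilate (h : SolvesEquation φ) {u : ℝ} (hu : u ≠ 0) (x : Hat k) :
    dilate φ (-u) (dilate φ u x) = retraction φ x := by
  rcases eq_or_ne u 1 with rfl | hu1
  · rw [dilate_one, retraction]
  · have h1 : 1 - u ≠ 0 := sub_ne_zero.2 hu1.symm
    have h2 := h.dilate_dilate hu h1 (by simp) x
    rw [sub_add_cancel, dilate_one] at h2
    have h3 : -1 + (1 - u) = -u := by ring
    rw [retraction, ← h2, h.dilate_dilate h1 (by norm_num) (by rw [h3]; exact neg_ne_zero.2 hu), h3]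

theorem SolvesEquation.retraction_scale (h : SolvesEquation φ) {c : ℝ} (hc : c ≠ 0) (x : Hat k) :
    retraction φ (scale c x) = scale c (retraction φ x) := by
  rw [← h.dilate_neg_dilate hc x, retraction, ← dilate_one (φ := φ), dilate_scale hc,
    dilate_scale hc, one_mul, neg_one_mul]

theorem SolvesEquation.map_retraction (h : SolvesEquation φ) (x : Hat k) :
    φ (retraction φ x) = φ x := by
  rw [← h.dilate_neg_dilate two_ne_zero, ← dilate_one (φ := φ),
    h.dilate_dilate (by norm_num) one_ne_zero (by norm_num),
    h.dilate_dilate (by norm_num) (by norm_num) (by norm_num)]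
  norm_num

theorem SolvesEquation.retraction_retraction (h : SolvesEquation φ) (x : Hat k) :
    retraction φ (retraction φ x) = retraction φ x := by
  rw [retraction, h.map_retraction, ← retraction]

theorem SolvesEquation.dilate_natCast (h : SolvesEquation φ) {n : ℕ} (hn : 1 ≤ n) (x : Hat k) :
    dilate φ n x = φ^[n] x := by
  induction n, hn using Nat.le_induction with
  | base => simp
  | succ n hn ih =>
    have hn0 : (n : ℝ) ≠ 0 := by positivity
    rw [Function.iterate_succ_apply', ← ih, ← dilate_one (φ := φ) (dilate φ n x),
      h.dilate_dilate hn0 one_ne_zero (by positivity), Nat.cast_succ, add_comm]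

variable {a : EuclideanSpace ℝ (Fin k)}

/-- The functional equation at `x = ∞`. -/
theorem SolvesEquation.map_smul (h : SolvesEquation φ) (ha : φ OnePoint.infty = a) {z : ℝ}
    (hz0 : z ≠ 0) (hz1 : z ≠ 1) :
    φ ((((1 - z) / z) • a : EuclideanSpace ℝ (Fin k)) : Hat k) =
      (((1 - z) • a : EuclideanSpace ℝ (Fin k)) : Hat k) := by
  have := h OnePoint.infty z hz0 hz1
  simpa [ha] using this.symm

theorem SolvesEquation.map_zero (h : SolvesEquation φ) (hφ : Continuous φ)
    (ha : φ OnePoint.infty = a) :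
    φ ((0 : EuclideanSpace ℝ (Fin k)) : Hat k) = ((0 : EuclideanSpace ℝ (Fin k)) : Hat k) := by
  have hc1 : Tendsto (fun z : ℝ => 1 - z) (𝓝[≠] 1) (𝓝 0) :=
    ((continuous_const.sub continuous_id).tendsto' 1 0 (by simp)).mono_left nhdsWithin_le_nhds
  have hc2 : Tendsto (fun z : ℝ => (1 - z) / z) (𝓝[≠] 1) (𝓝 0) := by
    have := hc1.div (tendsto_id.mono_left nhdsWithin_le_nhds) one_ne_zero
    rwa [zero_div] at this
  have h1 := (hφ.tendsto _).comp (tendsto_coe_smul hc2 a)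
  have h2 := tendsto_coe_smul hc1 a
  rw [zero_smul] at h1 h2
  refine tendsto_nhds_unique h1 (h2.congr' ?_)
  filter_upwards [self_mem_nhdsWithin,
    nhdsWithin_le_nhds (isOpen_ne.mem_nhds (one_ne_zero (α := ℝ)))] with z hz1 hz0
  exact (h.map_smul ha hz0 hz1).symm

theorem SolvesEquation.map_neg_eq_infty (h : SolvesEquation φ) (hφ : Continuous φ)
    (ha : φ OnePoint.infty = a) (ha0 : a ≠ 0) : φ ((-a : EuclideanSpace ℝ (Fin k)) : Hat k) =
      OnePoint.infty := by
  have hc1 : Tendsto (fun z : ℝ => |1 - z|) atTop atTop :=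
    tendsto_abs_atBot_atTop.comp (tendsto_const_nhds.add_atBot tendsto_neg_atTop_atBot)
  have hc2 : Tendsto (fun z : ℝ => (1 - z) / z) atTop (𝓝 (-1)) := by
    have : Tendsto (fun z : ℝ => z⁻¹ - 1) atTop (𝓝 (0 - 1)) :=
      tendsto_inv_atTop_zero.sub_const 1
    rw [zero_sub] at this
    refine this.congr' ?_
    filter_upwards [eventually_ne_atTop (0 : ℝ)] with z hz
    field_simp
  have h1 := (hφ.tendsto _).comp (tendsto_coe_smul hc2 a)
  rw [neg_one_smul] at h1
  refine tendsto_nhds_unique h1 ((tendsto_coe_smul_infty hc1 ha0).congr' ?_)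
  filter_upwards [eventually_ne_atTop (0 : ℝ), eventually_ne_atTop (1 : ℝ)] with z hz0 hz1
  exact (h.map_smul ha hz0 hz1).symm

theorem SolvesEquation.retraction_zero (h : SolvesEquation φ) (hφ : Continuous φ)
    (ha : φ OnePoint.infty = a) :
    retraction φ ((0 : EuclideanSpace ℝ (Fin k)) : Hat k) =
      ((0 : EuclideanSpace ℝ (Fin k)) : Hat k) := by
  simp [retraction, dilate, h.map_zero hφ ha]

theorem SolvesEquation.eq_zero_of_map_infty_eq_zero (h : SolvesEquation φ) (hφ : Continuous φ)
    (ha : φ OnePoint.infty = ((0 : EuclideanSpace ℝ (Fin k)) : Hat k)) (x : Hat k) :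
    φ x = ((0 : EuclideanSpace ℝ (Fin k)) : Hat k) := by
  have hinfty : retraction φ OnePoint.infty = ((0 : EuclideanSpace ℝ (Fin k)) : Hat k) := by
    simp [retraction, dilate, ha, h.map_zero hφ ha]
  have hret : retraction φ x = ((0 : EuclideanSpace ℝ (Fin k)) : Hat k) := by
    have hfix := h.retraction_retraction x
    generalize retraction φ x = y at hfix
    induction y using OnePoint.rec with
    | infty => rw [← hfix, hinfty]
    | coe v =>
      by_contra hv
      -- A fixed ray through `v` would force `∞` to be fixed as well.
      have hv0 : v ≠ 0 := fun h0 => hv (by rw [h0])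
      have h1 := ((continuous_retraction hφ).tendsto _).comp
        (tendsto_coe_smul_infty tendsto_abs_atTop_atTop hv0)
      have h2 : retraction φ OnePoint.infty = OnePoint.infty := by
        refine tendsto_nhds_unique h1
          ((tendsto_coe_smul_infty tendsto_abs_atTop_atTop hv0).congr' ?_)
        filter_upwards [eventually_ne_atTop (0 : ℝ)] with c hc
        rw [Function.comp_apply, ← scale_coe, h.retraction_scale hc, hfix]
      rw [hinfty] at h2
      exact OnePoint.coe_ne_infty _ h2
  rw [← h.map_retraction, hret, h.map_zero hφ ha]

theorem SolvesEquation.retraction_eq_self (h : SolvesEquation φ) (hφ : Continuous φ)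
    (ha : φ OnePoint.infty = a) (ha0 : a ≠ 0) (x : Hat k) : retraction φ x = x :=
  eq_self_of_homogeneous_retraction (continuous_retraction hφ)
    (fun _ x hc => h.retraction_scale hc x) h.retraction_retraction (h.retraction_zero hφ ha)
    (by simp [retraction, dilate, ha, h.map_neg_eq_infty hφ ha ha0]) x

end Solution

end HomotheticEq

theorem mainTheorem4 (k : ℕ) (hk : 1 ≤ k)
    (φ : HomotheticEq.Hat k → HomotheticEq.Hat k)
    (hcont : Continuous φ)
    (hsol : HomotheticEq.SolvesEquation φ)
    (a : EuclideanSpace ℝ (Fin k))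
    (ha : φ OnePoint.infty = (a : OnePoint (EuclideanSpace ℝ (Fin k))))
    (hne : ∃ x, φ x ≠ ((0 : EuclideanSpace ℝ (Fin k)) : OnePoint (EuclideanSpace ℝ (Fin k)))) :
    ∃ hbij : Function.Bijective φ,
      (∀ (n : ℕ), 1 ≤ n → ∀ x : HomotheticEq.Hat k,
        HomotheticEq.scale (1 / (n : ℝ)) (φ (HomotheticEq.scale (n : ℝ) x)) = φ^[n] x) ∧
      (∀ x : HomotheticEq.Hat k,
        (Equiv.ofBijective φ hbij).symm (HomotheticEq.scale (-1) x) =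
          HomotheticEq.scale (-1) (φ x)) := by
  have ha0 : a ≠ 0 := by
    rintro rfl
    obtain ⟨x, hx⟩ := hne
    exact hx (hsol.eq_zero_of_map_infty_eq_zero hcont ha x)
  have hret := hsol.retraction_eq_self hcont ha ha0
  have hbij : Function.Bijective φ := by
    refine ⟨Function.LeftInverse.injective (g := HomotheticEq.dilate φ (-1)) hret,
      Function.RightInverse.surjective (g := HomotheticEq.dilate φ (-1)) fun x => ?_⟩
    rw [← HomotheticEq.dilate_one (φ := φ) (HomotheticEq.dilate φ (-1) x)]
    simpa [hret] using hsol.dilate_neg_dilate (u := -1) (by norm_num) x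
  refine ⟨hbij, fun n hn x => ?_, fun x => ?_⟩
  · rw [one_div]
    exact hsol.dilate_natCast hn x
  · rw [Equiv.symm_apply_eq, Equiv.ofBijective_apply]
    nth_rw 1 [← hret x]
    simp [HomotheticEq.retraction, HomotheticEq.dilate, inv_neg]
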